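/- Let $K$ be an algebraically closed field and let $k,n$ be integers with $0<k<n$. Write $\mathbb{P}M_n(K)$ for the projective space of lines in the vector space $M_n(K)$ of $n\times n$ matrices over $K$, and $[A]\in\mathbb{P}M_n(K)$ for the class of a nonzero matrix $A$. Let $X_k\subseteq(\mathbb{P}M_n(K))^2$ be the set of pairs $([A],[B])$ for which there exist a $k$-dimensional space $U\subseteq (K^n)^*$ of row vectors with $UA\subseteq U$ and a $k$-dimensional space $V\subseteq K^n$ of column vectors with $BV\subseteq V$ such that the row-column multiplication $U\times V\to K$, $(u,v)\mapsto uv$, is degenerate (that is, not a nondegenerate bilinear pairing). Then $X_k$ is an irreducible projective variety: it is a Zariski closed subset of $(\mathbb{P}M_n(K))^2$ (the common zero locus of a set of polynomials in the entries of $A$ and $B$, each homogeneous in the entries of $A$ and homogeneous in the entries of $B$), and it is irreducible (in particular nonempty) in the Zariski topology. -/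

import Mathlib

open scoped Matrix LinearAlgebra.Projectivization

noncomputable section

namespace MatrixPairs

variable {K : Type*} [Field K] {n : ℕ}

/-- Polynomials over `K` in the `n² + n²` entries of a pair of `n × n` matrices:
`Sum.inl (i, j)` is the `(i, j)` entry of the first matrix, `Sum.inr (i, j)` that of the second. -/
abbrev PairPoly (K : Type*) [Field K] (n : ℕ) : Type _ :=
  MvPolynomial ((Fin n × Fin n) ⊕ (Fin n × Fin n)) K

/-- The value of a polynomial at a pair of matrices. -/
def evalPair (A B : Matrix (Fin n) (Fin n) K) (f : PairPoly K n) : K :=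
  MvPolynomial.eval (Sum.elim (fun p => A p.1 p.2) (fun p => B p.1 p.2)) f

/-- `f` is homogeneous of some degree `d` in the entries of the first matrix and homogeneous of
some degree `e` in the entries of the second matrix. -/
def IsBihomogeneous (f : PairPoly K n) : Prop :=
  ∃ d e : ℕ, MvPolynomial.IsWeightedHomogeneous
    (Sum.elim (fun _ => ((1, 0) : ℕ × ℕ)) (fun _ => ((0, 1) : ℕ × ℕ))) f (d, e)

/-- The set `(ℙ M_n(K))²`. -/
abbrev ProjPairs (K : Type*) [Field K] (n : ℕ) : Type _ :=
  ℙ K (Matrix (Fin n) (Fin n) K) × ℙ K (Matrix (Fin n) (Fin n) K)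

/-- `X` is a closed algebraic subset of `(ℙ M_n(K))²`: the common zero locus of a set of
bihomogeneous polynomials. -/
def IsAlgebraicSet (X : Set (ProjPairs K n)) : Prop :=
  ∃ S : Set (PairPoly K n), (∀ f ∈ S, IsBihomogeneous f) ∧
    ∀ (A B : Matrix (Fin n) (Fin n) K) (hA : A ≠ 0) (hB : B ≠ 0),
      (Projectivization.mk K A hA, Projectivization.mk K B hB) ∈ X ↔ ∀ f ∈ S, evalPair A B f = 0

theorem isAlgebraicSet_empty : IsAlgebraicSet (∅ : Set (ProjPairs K n)) := by
  refine ⟨{1}, ?_, ?_⟩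
  · rintro f rfl
    exact ⟨0, 0, MvPolynomial.isWeightedHomogeneous_one K _⟩
  · intro A B hA hB
    simp [evalPair]

theorem isAlgebraicSet_sInter (T : Set (Set (ProjPairs K n))) (hT : ∀ X ∈ T, IsAlgebraicSet X) :
    IsAlgebraicSet (⋂₀ T) := by
  choose S hS hX using hT
  refine ⟨{f | ∃ X, ∃ h : X ∈ T, f ∈ S X h}, ?_, ?_⟩
  · rintro f ⟨X, h, hf⟩
    exact hS X h f hf
  · intro A B hA hB
    constructor
    · rintro hm f ⟨X, h, hf⟩
      exact (hX X h A B hA hB).1 (hm X h) f hf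
    · intro hm X h
      exact (hX X h A B hA hB).2 fun f hf => hm f ⟨X, h, hf⟩

theorem isAlgebraicSet_union (X Y : Set (ProjPairs K n)) (hX : IsAlgebraicSet X)
    (hY : IsAlgebraicSet Y) : IsAlgebraicSet (X ∪ Y) := by
  obtain ⟨S, hS, hSX⟩ := hX
  obtain ⟨T, hT, hTY⟩ := hY
  refine ⟨{h | ∃ f ∈ S, ∃ g ∈ T, h = f * g}, ?_, ?_⟩
  · rintro _ ⟨f, hf, g, hg, rfl⟩
    obtain ⟨d, e, hd⟩ := hS f hf
    obtain ⟨d', e', hd'⟩ := hT g hg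
    exact ⟨d + d', e + e', hd.mul hd'⟩
  · intro A B hA hB
    rw [Set.mem_union, hSX A B hA hB, hTY A B hA hB]
    constructor
    · rintro h _ ⟨f, hf, g, hg, rfl⟩
      rcases h with h | h
      · have := h f hf
        simp_all [evalPair]
      · have := h g hg
        simp_all [evalPair]
    · intro h
      by_contra hc
      push Not at hc
      obtain ⟨⟨f, hf, hf0⟩, g, hg, hg0⟩ := hc
      have := h (f * g) ⟨f, hf, g, hg, rfl⟩
      simp only [evalPair, map_mul] at this hf0 hg0
      exact (mul_ne_zero hf0 hg0) this

/-- The Zariski topology on `(ℙ M_n(K))²`, whose closed sets are the zero loci of sets of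
bihomogeneous polynomials (equivalently, the topology induced by the Segre embedding). -/
@[reducible] def zariskiTopology (K : Type*) [Field K] (n : ℕ) : TopologicalSpace (ProjPairs K n) :=
  TopologicalSpace.ofClosed {X | IsAlgebraicSet X} isAlgebraicSet_empty
    (fun T hT => isAlgebraicSet_sInter T hT)
    (fun X hX Y hY => isAlgebraicSet_union X Y hX hY)

/-- An irreducible projective variety in `(ℙ M_n(K))²`: a Zariski closed set that is irreducible
(in particular nonempty) in the Zariski topology. -/
def IsIrreducibleProjectiveVariety (X : Set (ProjPairs K n)) : Prop :=
  @IsClosed _ (zariskiTopology K n) X ∧ @IsIrreducible _ (zariskiTopology K n) X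

/-- The row-column multiplication `U × V → K`, for a space `U` of row vectors and a space `V` of
column vectors. -/
def pairing (U V : Submodule K (Fin n → K)) : U →ₗ[K] V →ₗ[K] K :=
  (dotProductBilin K K).domRestrict₁₂ U V

/-- `U` is an invariant cosubspace of `A`: `U A ⊆ U` for the space `U` of row vectors. -/
def IsInvariantCosubspace (A : Matrix (Fin n) (Fin n) K) (U : Submodule K (Fin n → K)) : Prop :=
  ∀ u ∈ U, u ᵥ* A ∈ U

/-- `V` is an invariant subspace of `B`: `B V ⊆ V` for the space `V` of column vectors. -/
def IsInvariantSubspace (B : Matrix (Fin n) (Fin n) K) (V : Submodule K (Fin n → K)) : Prop :=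
  ∀ v ∈ V, B *ᵥ v ∈ V

/-- Pairs of `k`-dimensional spaces `U` of row vectors and `V` of column vectors with degenerate
row-column multiplication `U × V → K`. -/
def degeneratePairs (K : Type*) [Field K] (n k : ℕ) :
    Set (Submodule K (Fin n → K) × Submodule K (Fin n → K)) :=
  {P | Module.finrank K P.1 = k ∧ Module.finrank K P.2 = k ∧ ¬ (pairing P.1 P.2).Nondegenerate}

/-- The set `X_k` of pairs `([A], [B])` for which `A` has an invariant cosubspace `U` and `B` has
an invariant subspace `V`, both of dimension `k`, with degenerate pairing `U × V → K`. -/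
def invariantPairs (K : Type*) [Field K] (n k : ℕ) : Set (ProjPairs K n) :=
  {x | ∃ (A B : Matrix (Fin n) (Fin n) K) (hA : A ≠ 0) (hB : B ≠ 0),
    x = (Projectivization.mk K A hA, Projectivization.mk K B hB) ∧
    ∃ P ∈ degeneratePairs K n k, IsInvariantCosubspace A P.1 ∧ IsInvariantSubspace B P.2}

end MatrixPairs

end

/-! Closedness is properness of the Grassmannian, carried out by hand with valuations.
`HasDegenerateInvariants` records bases of the two spaces with one-sided inverses, so it makes sense
over any commutative ring and passes along ring homomorphisms and to products. Let every polynomial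
vanishing on all such pairs over `K` vanish at `(A, B)`. The generic matrices acquire degenerate
invariants over the product of copies of `K` indexed by those pairs. A suitable prime of this
product gives a field, and in it a valuation ring whose residue map sends the generic matrices to
`A` and `B` (`exists_field_factor`, `exists_valuationSubring_factor`). Rescaling bases by a minor of
maximal valuation makes them integral (`exists_integral_rows`), so the invariants reduce to the
residue field, and the Nullstellensatz brings them down to `K` (`HasDegenerateInvariants.descend`).
Stability under scaling each matrix allows the equations to be taken bihomogeneous.

For irreducibility, degeneracy means that some nonzero `v ∈ V` is annihilated by `U`. The
annihilator of `U` is an `A`-invariant subspace of dimension `n - k` containing `v`. Completing `v`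
to frames `p`, `q` adapted to this annihilator and to `V` makes `A` and `B` block triangular
matrices `a`, `b`. The conditions on `(p, q, a, b)` are linear, apart from the two nonvanishing
determinants. Hence a line in this parameter space joins any two points, and its image, with
denominators cleared by adjugates, is a rational curve in the set (`exists_polynomial_curve`). Two
nonempty relatively open subsets therefore meet on such a curve. -/

noncomputable section

namespace MatrixPairs

/-- An equational form, meaningful over any commutative ring, of the existence of an invariant
cosubspace of `A` (spanned by the rows of `M`) and an invariant subspace of `B` (spanned by the
columns of `N`), both of rank `k`, with degenerate pairing. -/
def HasDegenerateInvariants {R : Type*} [CommRing R] {n : ℕ} (k : ℕ)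
    (A B : Matrix (Fin n) (Fin n) R) : Prop :=
  ∃ (M : Matrix (Fin k) (Fin n) R) (M' : Matrix (Fin n) (Fin k) R)
    (N : Matrix (Fin n) (Fin k) R) (N' : Matrix (Fin k) (Fin n) R)
    (α β : Matrix (Fin k) (Fin k) R),
    M * M' = 1 ∧ N' * N = 1 ∧ M * A = α * M ∧ B * N = N * β ∧ (M * N).det = 0

/-! ### Base change and products. -/

section Transport

variable {R S : Type*} [CommRing R] [CommRing S] {n k : ℕ}

theorem HasDegenerateInvariants.map {A B : Matrix (Fin n) (Fin n) R}
    (h : HasDegenerateInvariants k A B) (φ : R →+* S) :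
    HasDegenerateInvariants k (A.map φ) (B.map φ) := by
  obtain ⟨M, M', N, N', α, β, h1, h2, h3, h4, h5⟩ := h
  refine ⟨M.map φ, M'.map φ, N.map φ, N'.map φ, α.map φ, β.map φ, ?_, ?_, ?_, ?_, ?_⟩
  · rw [← Matrix.map_mul, h1, Matrix.map_one _ φ.map_zero φ.map_one]
  · rw [← Matrix.map_mul, h2, Matrix.map_one _ φ.map_zero φ.map_one]
  · rw [← Matrix.map_mul, h3, Matrix.map_mul]
  · rw [← Matrix.map_mul, h4, Matrix.map_mul]
  · rw [← Matrix.map_mul, ← RingHom.mapMatrix_apply, ← RingHom.map_det, h5, map_zero]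

theorem matrix_pi_ext {ι : Type*} {m l : Type*} {A B : Matrix m l (ι → R)}
    (h : ∀ c, A.map (Pi.evalRingHom (fun _ => R) c) = B.map (Pi.evalRingHom (fun _ => R) c)) :
    A = B := by
  ext i j c
  exact congrFun (congrFun (h c) i) j

/-- Witnesses are chosen independently in each factor, since the defining equations hold in a
product exactly when they hold coordinatewise. -/
theorem HasDegenerateInvariants.pi {ι : Type*} {A B : Matrix (Fin n) (Fin n) (ι → R)}
    (h : ∀ c, HasDegenerateInvariants k (A.map (Pi.evalRingHom (fun _ => R) c))
      (B.map (Pi.evalRingHom (fun _ => R) c))) :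
    HasDegenerateInvariants k A B := by
  choose M M' N N' α β h1 h2 h3 h4 h5 using h
  refine ⟨Matrix.of fun i j c => M c i j, Matrix.of fun i j c => M' c i j,
    Matrix.of fun i j c => N c i j, Matrix.of fun i j c => N' c i j,
    Matrix.of fun i j c => α c i j, Matrix.of fun i j c => β c i j, ?_, ?_, ?_, ?_, ?_⟩
  · refine matrix_pi_ext fun c => ?_
    rw [Matrix.map_mul, Matrix.map_one _ (map_zero _) (map_one _)]
    exact h1 c
  · refine matrix_pi_ext fun c => ?_
    rw [Matrix.map_mul, Matrix.map_one _ (map_zero _) (map_one _)]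
    exact h2 c
  · refine matrix_pi_ext fun c => ?_
    rw [Matrix.map_mul, Matrix.map_mul]
    exact h3 c
  · refine matrix_pi_ext fun c => ?_
    rw [Matrix.map_mul, Matrix.map_mul]
    exact h4 c
  · funext c
    refine (RingHom.map_det (Pi.evalRingHom (fun _ => R) c) _).trans ?_
    rw [RingHom.mapMatrix_apply, Matrix.map_mul]
    exact h5 c

end Transport

/-! ### Descent to an algebraically closed field. -/

section Descent

/-- The weak Nullstellensatz: a nontrivial algebra of finite type over an algebraically closed
field has a rational point. -/
theorem exists_algHom_of_finiteType (K S : Type*) [Field K] [IsAlgClosed K] [CommRing S]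
    [Nontrivial S] [Algebra K S] [Algebra.FiniteType K S] : Nonempty (S →ₐ[K] K) := by
  obtain ⟨m, hm⟩ := Ideal.exists_maximal S
  let _ : Field (S ⧸ m) := Ideal.Quotient.field m
  have : Algebra.FiniteType K (S ⧸ m) :=
    Algebra.FiniteType.of_surjective (Ideal.Quotient.mkₐ K m) Ideal.Quotient.mk_surjective
  have : Module.Finite K (S ⧸ m) := finite_of_finite_type_of_isJacobsonRing K (S ⧸ m)
  exact ⟨(IsAlgClosed.lift : (S ⧸ m) →ₐ[K] K).comp (Ideal.Quotient.mkₐ K m)⟩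

theorem exists_map_subtype_eq {K L : Type*} [Field K] [CommRing L] [Algebra K L]
    {S : Subalgebra K L} {m l : Type*} {A : Matrix m l L} (h : ∀ i j, A i j ∈ S) :
    ∃ A' : Matrix m l S, A'.map S.val = A :=
  ⟨Matrix.of fun i j => ⟨A i j, h i j⟩, rfl⟩

/-- The witnesses have finitely many entries, so they live in a `K`-subalgebra of finite type. A
`K`-point of that subalgebra specializes them and fixes the entries of `A` and `B`. -/
theorem HasDegenerateInvariants.descend {K L : Type*} [Field K] [IsAlgClosed K] [CommRing L]
    [Nontrivial L] [Algebra K L] {n k : ℕ} {A B : Matrix (Fin n) (Fin n) K}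
    (h : HasDegenerateInvariants k (A.map (algebraMap K L)) (B.map (algebraMap K L))) :
    HasDegenerateInvariants k A B := by
  classical
  obtain ⟨M, M', N, N', α, β, h1, h2, h3, h4, h5⟩ := h
  obtain ⟨S, _, hM, hM', hN, hN', hα, hβ⟩ : ∃ S : Subalgebra K L, Algebra.FiniteType K S ∧
      (∀ i j, M i j ∈ S) ∧ (∀ i j, M' i j ∈ S) ∧ (∀ i j, N i j ∈ S) ∧ (∀ i j, N' i j ∈ S) ∧
      (∀ i j, α i j ∈ S) ∧ (∀ i j, β i j ∈ S) := by
    let s : Set L := Set.range (Function.uncurry M) ∪ Set.range (Function.uncurry M') ∪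
      Set.range (Function.uncurry N) ∪ Set.range (Function.uncurry N') ∪
      Set.range (Function.uncurry α) ∪ Set.range (Function.uncurry β)
    have hs : s.Finite := by
      simp only [s, Set.finite_union]
      simp [Set.finite_range]
    have hmem : ∀ {m l : Type} (A : Matrix m l L), Set.range (Function.uncurry A) ⊆ s →
        ∀ i j, A i j ∈ Algebra.adjoin K s :=
      fun A hA i j => Algebra.subset_adjoin (hA ⟨(i, j), rfl⟩)
    refine ⟨Algebra.adjoin K s, (Subalgebra.fg_iff_finiteType _).1 ⟨hs.toFinset, by simp⟩,
      hmem _ ?_, hmem _ ?_, hmem _ ?_, hmem _ ?_, hmem _ ?_, hmem _ ?_⟩ <;>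
    · intro x hx
      simp only [s, Set.mem_union]
      tauto
  obtain ⟨M, rfl⟩ := exists_map_subtype_eq hM
  obtain ⟨M', rfl⟩ := exists_map_subtype_eq hM'
  obtain ⟨N, rfl⟩ := exists_map_subtype_eq hN
  obtain ⟨N', rfl⟩ := exists_map_subtype_eq hN'
  obtain ⟨α, rfl⟩ := exists_map_subtype_eq hα
  obtain ⟨β, rfl⟩ := exists_map_subtype_eq hβ
  have hinj : Function.Injective S.val := Subtype.val_injective
  have hA : ∀ A : Matrix (Fin n) (Fin n) K,
      A.map (algebraMap K L) = (A.map (algebraMap K S)).map S.val := fun A => rfl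
  rw [hA] at h3 h4
  have key : HasDegenerateInvariants k (A.map (algebraMap K S)) (B.map (algebraMap K S)) := by
    refine ⟨M, M', N, N', α, β, ?_, ?_, ?_, ?_, ?_⟩
    · apply Matrix.map_injective hinj
      dsimp only
      rw [Matrix.map_mul, h1, Matrix.map_one _ (map_zero _) (map_one _)]
    · apply Matrix.map_injective hinj
      dsimp only
      rw [Matrix.map_mul, h2, Matrix.map_one _ (map_zero _) (map_one _)]
    · apply Matrix.map_injective hinj
      dsimp only
      rw [Matrix.map_mul, h3, Matrix.map_mul]
    · apply Matrix.map_injective hinj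
      dsimp only
      rw [Matrix.map_mul, h4, Matrix.map_mul]
    · apply hinj
      rw [map_zero, AlgHom.map_det, AlgHom.mapMatrix_apply, Matrix.map_mul, h5]
  obtain ⟨φ⟩ := exists_algHom_of_finiteType K S
  have := key.map φ.toRingHom
  have hφ : ∀ A : Matrix (Fin n) (Fin n) K, (A.map (algebraMap K S)).map φ.toRingHom = A := by
    intro A
    ext i j
    simp
  rwa [hφ, hφ] at this

end Descent

/-! ### Integral bases over a valuation ring. -/

section Valuation

/-- Multilinear expansion of `det (M'ᵀ * Mᵀ) = 1` writes `1` as a combination of the minors of `M`,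
with repeated columns allowed, so they cannot all vanish. -/
theorem exists_det_submatrix_ne_zero {R : Type*} [CommRing R] [Nontrivial R] {n k : ℕ}
    {M : Matrix (Fin k) (Fin n) R}
    {M' : Matrix (Fin n) (Fin k) R} (h : M * M' = 1) :
    ∃ f : Fin k → Fin n, (M.submatrix id f).det ≠ 0 := by
  by_contra! hc
  have h1 : (M'ᵀ * Mᵀ).det = 1 := by rw [← Matrix.transpose_mul, h]; simp
  have h2 : M'ᵀ * Mᵀ = Matrix.of fun i => ∑ j, M'ᵀ i j • Mᵀ j := by
    ext i l
    simp [Matrix.mul_apply, Finset.sum_apply]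
  have h3 : (M'ᵀ * Mᵀ).det = Matrix.detRowAlternating.toMultilinearMap
      (fun i => ∑ j, M'ᵀ i j • Mᵀ j) := by rw [h2]; rfl
  rw [MultilinearMap.map_sum] at h3
  rw [h1, Finset.sum_eq_zero] at h3
  · exact one_ne_zero h3
  · intro f _
    rw [MultilinearMap.map_smul_univ]
    have : Matrix.detRowAlternating.toMultilinearMap (fun i => Mᵀ (f i)) =
        (M.submatrix id f).det := by
      rw [← Matrix.det_transpose]; rfl
    rw [this, hc, smul_zero]

variable {F : Type*} [Field F] (O : ValuationSubring F) {n k : ℕ}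

/-- A space of row vectors over the fraction field of a valuation ring has a basis whose
coordinate matrix is integral and right invertible over the ring. -/
theorem exists_integral_rows {A : Matrix (Fin n) (Fin n) O} {M : Matrix (Fin k) (Fin n) F}
    {M' : Matrix (Fin n) (Fin k) F} {α : Matrix (Fin k) (Fin k) F} (h : M * M' = 1)
    (hA : M * A.map O.subtype = α * M) :
    ∃ (L : Matrix (Fin k) (Fin n) O) (L' : Matrix (Fin n) (Fin k) O)
      (γ : Matrix (Fin k) (Fin k) O) (c : Matrix (Fin k) (Fin k) F),
      L * L' = 1 ∧ L * A = γ * L ∧ L.map O.subtype = c * M := by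
  classical
  obtain ⟨f₀, hf₀⟩ := exists_det_submatrix_ne_zero h
  -- Normalizing by the minor of largest valuation turns the entries of `D⁻¹ * M` into quotients of
  -- minors of valuation at most `1`.
  obtain ⟨f, -, hf⟩ := Finset.exists_max_image (Finset.univ : Finset (Fin k → Fin n))
    (fun f => O.valuation (M.submatrix id f).det) ⟨f₀, Finset.mem_univ _⟩
  set D := M.submatrix id f with hD
  have hD0 : D.det ≠ 0 := by
    intro h0
    have := hf f₀ (Finset.mem_univ _)
    simp only [h0, map_zero, le_zero_iff, map_eq_zero] at this
    exact hf₀ this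
  have hDu : IsUnit D.det := hD0.isUnit
  have hentry : ∀ i j, (D⁻¹ * M) i j ∈ O := by
    intro i j
    -- Cramer's rule: replacing column `i` of `D` by column `j` of `M` gives the minor for the
    -- updated choice of columns.
    have h1 : (D⁻¹ * M) i j = D.det⁻¹ * (M.submatrix id (Function.update f i j)).det := by
      have : (D⁻¹ * M) i j = (D⁻¹ *ᵥ (fun l => M l j)) i := rfl
      rw [this, Matrix.inv_def, Matrix.smul_mulVec, ← Matrix.cramer_eq_adjugate_mulVec,
        Pi.smul_apply, Matrix.cramer_apply, smul_eq_mul, Ring.inverse_eq_inv']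
      congr 2
      ext a b
      by_cases hb : b = i
      · subst hb; simp
      · simp [hD, Matrix.updateCol_ne hb, Function.update_of_ne hb]
    rw [← ValuationSubring.valuation_le_one_iff, h1, map_mul, map_inv₀]
    have hv : O.valuation D.det ≠ 0 := (map_ne_zero _).2 hD0
    exact (inv_mul_le_one₀ (zero_lt_iff.2 hv)).2 (hf _ (Finset.mem_univ _))
  let L : Matrix (Fin k) (Fin n) O := Matrix.of fun i j => ⟨(D⁻¹ * M) i j, hentry i j⟩
  -- The columns of `L` selected by `f` form the identity matrix, so selecting them is a right
  -- inverse.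
  let L' : Matrix (Fin n) (Fin k) O := (1 : Matrix (Fin n) (Fin n) O).submatrix id f
  have hinj : Function.Injective O.subtype := Subtype.val_injective
  have hL : L.map O.subtype = D⁻¹ * M := rfl
  have hLL : L * L' = 1 := by
    apply Matrix.map_injective hinj
    dsimp only
    rw [Matrix.map_mul, hL, Matrix.map_one _ (map_zero _) (map_one _)]
    have : L'.map O.subtype = (1 : Matrix (Fin n) (Fin n) F).submatrix id f := by
      rw [← Matrix.submatrix_map, Matrix.map_one _ (map_zero _) (map_one _)]
    rw [this, Matrix.mul_assoc]
    have : M * (1 : Matrix (Fin n) (Fin n) F).submatrix id f = D := by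
      ext i j
      simp [hD, Matrix.mul_apply, Matrix.one_apply]
    rw [this, Matrix.nonsing_inv_mul _ hDu]
  refine ⟨L, L', L * A * L', D⁻¹, hLL, ?_, hL⟩
  have h2 : L.map O.subtype * A.map O.subtype = (D⁻¹ * α * D) * L.map O.subtype := by
    rw [hL, Matrix.mul_assoc, hA, Matrix.mul_assoc (D⁻¹ * α), ← Matrix.mul_assoc D,
      Matrix.mul_nonsing_inv _ hDu, Matrix.one_mul, Matrix.mul_assoc]
  have hLL' : L.map O.subtype * L'.map O.subtype = 1 := by
    rw [← Matrix.map_mul, hLL, Matrix.map_one _ (map_zero _) (map_one _)]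
  apply Matrix.map_injective hinj
  dsimp only
  rw [Matrix.map_mul, Matrix.map_mul, Matrix.map_mul, Matrix.map_mul, h2,
    Matrix.mul_assoc _ _ (L'.map O.subtype), hLL', Matrix.mul_one]

/-- The columns of `N` are handled as rows of `Nᵀ`. Changing both bases multiplies the determinant
of the pairing matrix by constants, so it stays zero. -/
theorem HasDegenerateInvariants.of_valuationSubring {A B : Matrix (Fin n) (Fin n) O}
    (h : HasDegenerateInvariants k (A.map O.subtype) (B.map O.subtype)) :
    HasDegenerateInvariants k A B := by
  obtain ⟨M, M', N, N', α, β, h1, h2, h3, h4, h5⟩ := h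
  obtain ⟨L, L', γ, c, hL, hA, hc⟩ := exists_integral_rows O h1 h3
  obtain ⟨P, P', δ, d, hP, hB, hd⟩ := exists_integral_rows O (A := Bᵀ) (M := Nᵀ) (M' := N'ᵀ)
    (α := βᵀ) (by rw [← Matrix.transpose_mul, h2, Matrix.transpose_one])
    (by rw [Matrix.transpose_map, ← Matrix.transpose_mul, h4, Matrix.transpose_mul])
  refine ⟨L, L', Pᵀ, P'ᵀ, γ, δᵀ, hL, ?_, hA, ?_, ?_⟩
  · rw [← Matrix.transpose_mul, hP, Matrix.transpose_one]
  · rw [← Matrix.transpose_mul, ← hB, Matrix.transpose_mul, Matrix.transpose_transpose]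
  · have hinj : Function.Injective O.subtype := Subtype.val_injective
    apply hinj
    rw [RingHom.map_zero, RingHom.map_det, RingHom.mapMatrix_apply, Matrix.map_mul, Matrix.transpose_map, hc,
      hd, Matrix.transpose_mul, Matrix.transpose_transpose, Matrix.mul_assoc, ← Matrix.mul_assoc M,
      Matrix.det_mul, Matrix.det_mul, h5, zero_mul, mul_zero]

end Valuation

/-! ### The valuative argument for closedness. -/

section Closure

universe u

/-- A ring homomorphism to a field whose kernel lies in a prime ideal `P` factors through a
valuation ring whose maximal ideal lies over `P`. -/
theorem exists_valuationSubring_factor {T F : Type*} [CommRing T] [Field F] (ψ : T →+* F)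
    (P : Ideal T) (hP : P ≠ ⊤) (hψ : RingHom.ker ψ ≤ P) :
    ∃ (O : ValuationSubring F) (θ : T →+* O), O.subtype.comp θ = ψ ∧
      ∀ f ∈ P, IsLocalRing.residue O (θ f) = 0 := by
  let I : Ideal ψ.range := P.map ψ.rangeRestrict
  have hI : I ≠ ⊤ := by
    intro hI
    have h1 : (1 : ψ.range) ∈ I := hI ▸ Submodule.mem_top
    obtain ⟨f, hf, hf1⟩ := (Ideal.mem_map_iff_of_surjective _ ψ.rangeRestrict_surjective).1 h1
    have h2 : ψ (1 - f) = 0 := by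
      rw [map_sub, map_one, sub_eq_zero]
      exact (congrArg Subtype.val hf1).symm
    have := P.add_mem hf (hψ h2)
    rw [add_sub_cancel] at this
    exact hP ((Ideal.eq_top_iff_one _).2 this)
  obtain ⟨O, hO, hOI⟩ := Ideal.image_subset_nonunits_valuationSubring I hI
  refine ⟨O, ψ.codRestrict O.toSubring fun f => hO ⟨f, rfl⟩, rfl, fun f hf => ?_⟩
  refine (IsLocalRing.residue_eq_zero_iff _).2 ?_
  have h1 : ψ f ∈ O.nonunits := hOI ⟨ψ.rangeRestrict f, Ideal.mem_map_of_mem _ hf, rfl⟩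
  exact (ValuationSubring.coe_mem_nonunits_iff (a := ⟨ψ f, hO ⟨f, rfl⟩⟩)).1 h1

/-- Some prime `Q` of `R` contracts into `P`, because the image of the complement of `P` is a
multiplicative set avoiding `0`. The field is the fraction field of `R ⧸ Q`. -/
theorem exists_field_factor {T : Type*} {R : Type u} [CommRing T] [CommRing R] (φ : T →+* R)
    (P : Ideal T) [P.IsPrime] (hφ : RingHom.ker φ ≤ P) :
    ∃ (F : Type u) (_ : Field F) (π : R →+* F), RingHom.ker (π.comp φ) ≤ P := by
  obtain ⟨Q, -, hQ, hQP⟩ := Ideal.exists_ideal_comap_le_prime (f := φ) P ⊥ hφ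
  refine ⟨FractionRing (R ⧸ Q), inferInstance,
    (algebraMap (R ⧸ Q) (FractionRing (R ⧸ Q))).comp (Ideal.Quotient.mk Q), fun f hf => hQP ?_⟩
  have : Ideal.Quotient.mk Q (φ f) = 0 :=
    IsFractionRing.injective (R ⧸ Q) (FractionRing (R ⧸ Q)) (by rw [map_zero]; exact hf)
  exact (Ideal.Quotient.eq_zero_iff_mem (I := Q)).1 this

variable {K : Type*} [Field K] {n k : ℕ}

/-- The pairs of matrices with degenerate invariants form a Zariski closed set. -/
theorem hasDegenerateInvariants_of_forall_evalPair_eq_zero [IsAlgClosed K]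
    {A B : Matrix (Fin n) (Fin n) K}
    (h : ∀ f : PairPoly K n, (∀ A' B' : Matrix (Fin n) (Fin n) K,
      HasDegenerateInvariants k A' B' → evalPair A' B' f = 0) → evalPair A B f = 0) :
    HasDegenerateInvariants k A B := by
  let C := {c : Matrix (Fin n) (Fin n) K × Matrix (Fin n) (Fin n) K //
    HasDegenerateInvariants k c.1 c.2}
  let ev (A B : Matrix (Fin n) (Fin n) K) : PairPoly K n →+* K :=
    MvPolynomial.eval (Sum.elim (fun p => A p.1 p.2) (fun p => B p.1 p.2))
  let XA : Matrix (Fin n) (Fin n) (PairPoly K n) :=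
    Matrix.of fun i j => MvPolynomial.X (Sum.inl (i, j))
  let XB : Matrix (Fin n) (Fin n) (PairPoly K n) :=
    Matrix.of fun i j => MvPolynomial.X (Sum.inr (i, j))
  let φ : PairPoly K n →+* (C → K) := RingHom.pi fun c => ev c.1.1 c.1.2
  let P : Ideal (PairPoly K n) := RingHom.ker (ev A B)
  have hPp : P.IsPrime := RingHom.ker_isPrime _
  have hle : RingHom.ker φ ≤ P := by
    intro f hf
    refine h f fun A' B' hAB => ?_
    exact congrFun (show φ f = 0 from hf) ⟨(A', B'), hAB⟩
  obtain ⟨F, _, π, hπ⟩ := exists_field_factor φ P hle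
  obtain ⟨O, θ, hθ, hres⟩ := exists_valuationSubring_factor (π.comp φ) P hPp.ne_top hπ
  let ρ : PairPoly K n →+* IsLocalRing.ResidueField O :=
    (IsLocalRing.residue O).comp θ
  have hρ : ∀ f ∈ P, ρ f = 0 := hres
  -- This algebra structure comes from the constant polynomials, so that reducing a polynomial
  -- modulo `P` agrees with evaluating it at `(A, B)`.
  let _ : Algebra K (IsLocalRing.ResidueField O) := (ρ.comp MvPolynomial.C).toAlgebra
  have hρX : ∀ (A' : Matrix (Fin n) (Fin n) K) (X : Matrix (Fin n) (Fin n) (PairPoly K n)),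
      X.map (ev A B) = A' → X.map ρ = A'.map (algebraMap K (IsLocalRing.ResidueField O)) := by
    rintro _ X rfl
    ext i j
    have h1 : X i j - MvPolynomial.C (ev A B (X i j)) ∈ P := by
      simp [P, RingHom.mem_ker, ev]
    have h2 := hρ _ h1
    rw [map_sub, sub_eq_zero] at h2
    exact h2
  have hφ : HasDegenerateInvariants k (XA.map φ) (XB.map φ) := by
    refine HasDegenerateInvariants.pi fun c => ?_
    have hA : (XA.map φ).map (Pi.evalRingHom (fun _ => K) c) = c.1.1 := by
      ext i j; simp [XA, φ, ev]
    have hB : (XB.map φ).map (Pi.evalRingHom (fun _ => K) c) = c.1.2 := by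
      ext i j; simp [XB, φ, ev]
    rw [hA, hB]
    exact c.2
  have hO : ∀ X : Matrix (Fin n) (Fin n) (PairPoly K n),
      (X.map φ).map π = (X.map θ).map O.subtype := fun X => by
    ext i j
    exact (RingHom.congr_fun hθ (X i j)).symm
  have hF := hφ.map π
  rw [hO, hO] at hF
  have hres : HasDegenerateInvariants k (XA.map ρ) (XB.map ρ) :=
    (HasDegenerateInvariants.of_valuationSubring O hF).map (IsLocalRing.residue O)
  rw [hρX A XA (by ext i j; simp [XA, ev]), hρX B XB (by ext i j; simp [XB, ev])] at hres
  exact hres.descend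

end Closure

/-! ### Reduction to bihomogeneous equations. -/

section Homogeneity

variable {K σ : Type*} [Field K]

theorem eval_aeval_polynomial (g : σ → Polynomial K) (f : MvPolynomial σ K) (t : K) :
    (MvPolynomial.aeval g f).eval t = MvPolynomial.eval (fun i => (g i).eval t) f := by
  rw [← Polynomial.coe_evalRingHom, MvPolynomial.aeval_def, MvPolynomial.hom_eval₂]
  have : (Polynomial.evalRingHom t).comp (algebraMap K (Polynomial K)) = RingHom.id K := by
    ext; simp
  rw [this]
  rfl

/-- Along the weighted orbit of `x`, a monomial of weight `d` contributes its value at `x` times `X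
^ d`. -/
theorem coeff_aeval_X_pow_mul_C (w : σ → ℕ) (x : σ → K) (f : MvPolynomial σ K) (d : ℕ) :
    (MvPolynomial.aeval (fun i => (Polynomial.X ^ w i * Polynomial.C (x i) : Polynomial K))
      f).coeff d = MvPolynomial.eval x (MvPolynomial.weightedHomogeneousComponent w d f) := by
  classical
  induction f using MvPolynomial.induction_on' with
  | monomial m c =>
    have h1 : MvPolynomial.aeval (fun i => (Polynomial.X ^ w i * Polynomial.C (x i) : Polynomial K))
        (MvPolynomial.monomial m c) =
        Polynomial.C (MvPolynomial.eval x (MvPolynomial.monomial m c)) *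
          Polynomial.X ^ (Finsupp.weight w m) := by
      rw [MvPolynomial.aeval_monomial, MvPolynomial.eval_monomial, Finsupp.weight_apply,
        Finsupp.prod, Finsupp.prod, Finsupp.sum, Polynomial.C_mul, ← Finset.prod_pow_eq_pow_sum,
        map_prod, mul_assoc, ← Finset.prod_mul_distrib]
      congr 1
      refine Finset.prod_congr rfl fun i _ => ?_
      rw [mul_pow, ← pow_mul, smul_eq_mul, mul_comm (m i), Polynomial.C_pow, mul_comm]
    rw [h1, Polynomial.coeff_C_mul_X_pow]
    have h2 : MvPolynomial.weightedHomogeneousComponent w d (MvPolynomial.monomial m c) =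
        if Finsupp.weight w m = d then MvPolynomial.monomial m c else 0 := by
      ext m'
      rw [MvPolynomial.coeff_weightedHomogeneousComponent]
      by_cases h : m = m'
      · subst h
        split_ifs <;> simp
      · split_ifs <;> simp [h]
    rw [h2]
    by_cases h : Finsupp.weight w m = d
    · simp [h]
    · simp [h, Ne.symm h]
  | add f g hf hg => rw [map_add, map_add, map_add, Polynomial.coeff_add, hf, hg]

/-- A polynomial vanishing on an orbit of a weighted action of the affine line has all its
weighted homogeneous components vanishing there. -/
theorem eval_weightedHomogeneousComponent_eq_zero [Infinite K] {w : σ → ℕ} {x : σ → K}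
    {f : MvPolynomial σ K} (h : ∀ t : K, MvPolynomial.eval (fun i => t ^ w i * x i) f = 0) (d : ℕ) :
    MvPolynomial.eval x (MvPolynomial.weightedHomogeneousComponent w d f) = 0 := by
  rw [← coeff_aeval_X_pow_mul_C]
  have : MvPolynomial.aeval (fun i => (Polynomial.X ^ w i * Polynomial.C (x i) : Polynomial K)) f
      = 0 := by
    refine Polynomial.funext fun t => ?_
    rw [eval_aeval_polynomial, Polynomial.eval_zero, ← h t]
    simp only [Polynomial.eval_mul, Polynomial.eval_pow, Polynomial.eval_X, Polynomial.eval_C]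
  rw [this, Polynomial.coeff_zero]

theorem eval_eq_zero_of_forall_weightedHomogeneousComponent {w : σ → ℕ} {x : σ → K}
    {f : MvPolynomial σ K}
    (h : ∀ d, MvPolynomial.eval x (MvPolynomial.weightedHomogeneousComponent w d f) = 0) :
    MvPolynomial.eval x f = 0 := by
  rw [← MvPolynomial.sum_weightedHomogeneousComponent w f,
    finsum_eq_sum _ (MvPolynomial.weightedHomogeneousComponent_finsupp f), map_sum]
  exact Finset.sum_eq_zero fun d _ => h d

variable {n : ℕ}

theorem isBihomogeneous_component (f : PairPoly K n) (d e : ℕ) :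
    IsBihomogeneous (MvPolynomial.weightedHomogeneousComponent
      (Sum.elim (fun _ => 0) (fun _ => 1) : _ → ℕ) e
      (MvPolynomial.weightedHomogeneousComponent
        (Sum.elim (fun _ => 1) (fun _ => 0) : _ → ℕ) d f)) := by
  classical
  refine ⟨d, e, fun m hm => ?_⟩
  rw [MvPolynomial.coeff_weightedHomogeneousComponent] at hm
  split_ifs at hm with h2
  · rw [MvPolynomial.coeff_weightedHomogeneousComponent] at hm
    split_ifs at hm with h1
    · rw [← h1, ← h2]
      simp only [Finsupp.weight_apply, Finsupp.sum]
      refine Prod.ext ?_ ?_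
      · simp only [Prod.fst_sum]
        refine Finset.sum_congr rfl ?_
        rintro (i | i) _ <;> simp
      · simp only [Prod.snd_sum]
        refine Finset.sum_congr rfl ?_
        rintro (i | i) _ <;> simp
    · exact absurd rfl hm
  · exact absurd rfl hm

/-- For a set of pairs of matrices stable under scaling either matrix, vanishing of bihomogeneous
polynomials controls vanishing of all polynomials. -/
theorem evalPair_eq_zero_of_bihomogeneous [Infinite K]
    {C : Matrix (Fin n) (Fin n) K → Matrix (Fin n) (Fin n) K → Prop}
    (hC : ∀ A B (s t : K), C A B → C (s • A) (t • B)) {A B : Matrix (Fin n) (Fin n) K}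
    (h : ∀ f : PairPoly K n, IsBihomogeneous f → (∀ A' B', C A' B' → evalPair A' B' f = 0) →
      evalPair A B f = 0)
    {f : PairPoly K n} (hf : ∀ A' B', C A' B' → evalPair A' B' f = 0) : evalPair A B f = 0 := by
  have h1 : ∀ d, ∀ A' B', C A' B' → evalPair A' B' (MvPolynomial.weightedHomogeneousComponent
        (Sum.elim (fun _ => 1) (fun _ => 0) : _ → ℕ) d f) = 0 := by
    intro d A' B' hAB
    refine eval_weightedHomogeneousComponent_eq_zero (fun t => ?_) d
    rw [← hf _ _ (hC A' B' t 1 hAB), evalPair]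
    congr 2
    ext (i | i) <;> simp
  have h2 : ∀ d e, ∀ A' B', C A' B' → evalPair A' B' (MvPolynomial.weightedHomogeneousComponent
      (Sum.elim (fun _ => 0) (fun _ => 1) : _ → ℕ) e
      (MvPolynomial.weightedHomogeneousComponent
        (Sum.elim (fun _ => 1) (fun _ => 0) : _ → ℕ) d f)) = 0 := by
    intro d e A' B' hAB
    refine eval_weightedHomogeneousComponent_eq_zero (fun t => ?_) e
    rw [← h1 d _ _ (hC A' B' 1 t hAB), evalPair]
    congr 2
    ext (i | i) <;> simp
  exact eval_eq_zero_of_forall_weightedHomogeneousComponent fun d =>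
    eval_eq_zero_of_forall_weightedHomogeneousComponent fun e =>
      h _ (isBihomogeneous_component f d e) (h2 d e)

end Homogeneity

/-! ### Matrices versus subspaces. -/

section Subspaces

variable {K : Type*} [Field K] {n k : ℕ}

theorem HasDegenerateInvariants.smul {A B : Matrix (Fin n) (Fin n) K}
    (h : HasDegenerateInvariants k A B) (s t : K) :
    HasDegenerateInvariants k (s • A) (t • B) := by
  obtain ⟨M, M', N, N', α, β, h1, h2, h3, h4, h5⟩ := h
  refine ⟨M, M', N, N', s • α, t • β, h1, h2, ?_, ?_, h5⟩
  · rw [Matrix.mul_smul, h3, Matrix.smul_mul]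
  · rw [Matrix.smul_mul, h4, Matrix.mul_smul]

theorem exists_rows_of_invariantCosubspace {A : Matrix (Fin n) (Fin n) K}
    {U : Submodule K (Fin n → K)} (hU : Module.finrank K U = k)
    (hA : IsInvariantCosubspace A U) :
    ∃ (M : Matrix (Fin k) (Fin n) K) (M' : Matrix (Fin n) (Fin k) K)
      (α : Matrix (Fin k) (Fin k) K),
      M * M' = 1 ∧ M * A = α * M ∧ U = LinearMap.range M.vecMulLinear := by
  let b := Module.finBasisOfFinrankEq K U hU
  let M : Matrix (Fin k) (Fin n) K := Matrix.of fun i => (b i : Fin n → K)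
  have hM : M.vecMulLinear = U.subtype ∘ₗ b.equivFun.symm.toLinearMap := by
    refine LinearMap.ext fun x => ?_
    simp only [LinearMap.comp_apply, LinearEquiv.coe_coe, Module.Basis.equivFun_symm_apply, map_sum,
      map_smul, Submodule.subtype_apply, Matrix.vecMulLinear_apply]
    rw [Matrix.vecMul_eq_sum]
    rfl
  have hrange : U = LinearMap.range M.vecMulLinear := by
    rw [hM, LinearMap.range_comp, LinearEquiv.range, Submodule.map_top, Submodule.range_subtype]
  have hker : LinearMap.ker M.vecMulLinear = ⊥ := by
    rw [LinearMap.ker_eq_bot, hM]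
    exact Subtype.val_injective.comp b.equivFun.symm.injective
  -- A left inverse of `x ↦ x ᵥ* M` supplies `M'`; the transpose below converts its column action
  -- into a row action.
  obtain ⟨g, hg⟩ := LinearMap.exists_leftInverse_of_injective _ hker
  have hα : ∀ i, ∃ y, y ᵥ* M = M i ᵥ* A := by
    intro i
    have : M i ᵥ* A ∈ LinearMap.range M.vecMulLinear := hrange ▸ hA _ (b i).2
    exact this
  choose α hα using hα
  refine ⟨M, (LinearMap.toMatrix' g)ᵀ, Matrix.of α, ?_, ?_, hrange⟩
  · refine Matrix.ext_of_single_vecMul fun i => ?_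
    rw [← Matrix.vecMul_vecMul, Matrix.vecMul_transpose, LinearMap.toMatrix'_mulVec,
      Matrix.vecMul_one]
    exact LinearMap.congr_fun hg _
  · ext i j
    rw [Matrix.mul_apply_eq_vecMul, Matrix.mul_apply_eq_vecMul]
    exact (congrFun (hα i) j).symm

/-- In coordinates the pairing has Gram matrix `M * N`. The right inverse of `M` makes `x ↦ x ᵥ* M`
injective; no such condition on `N` is needed, as invertibility of `M * N` suffices. -/
theorem pairing_nondegenerate_iff {M : Matrix (Fin k) (Fin n) K} {M' : Matrix (Fin n) (Fin k) K}
    {N : Matrix (Fin n) (Fin k) K} (hM : M * M' = 1) :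
    (pairing (LinearMap.range M.vecMulLinear) (LinearMap.range N.mulVecLin)).Nondegenerate ↔
      (M * N).det ≠ 0 := by
  have hpair : ∀ x y, pairing (LinearMap.range M.vecMulLinear) (LinearMap.range N.mulVecLin)
      ⟨x ᵥ* M, x, rfl⟩ ⟨N *ᵥ y, y, rfl⟩ = x ⬝ᵥ (M * N) *ᵥ y := by
    intro x y
    change (x ᵥ* M) ⬝ᵥ (N *ᵥ y) = _
    rw [← Matrix.dotProduct_mulVec, Matrix.mulVec_mulVec]
  constructor
  · intro h hdet
    obtain ⟨x, hx0, hx⟩ := Matrix.exists_vecMul_eq_zero_iff.2 hdet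
    have := h.1 ⟨x ᵥ* M, x, rfl⟩ (by
      rintro ⟨_, y, rfl⟩
      refine (hpair x y).trans ?_
      rw [Matrix.dotProduct_mulVec, hx, zero_dotProduct])
    have h0 : x ᵥ* M = 0 := congrArg Subtype.val this
    apply hx0
    rw [← Matrix.vecMul_one x, ← hM, ← Matrix.vecMul_vecMul, h0, Matrix.zero_vecMul]
  · intro hdet
    constructor
    · rintro ⟨_, x, rfl⟩ h
      have hx : x ᵥ* (M * N) = 0 := by
        refine dotProduct_eq_zero _ fun y => ?_
        rw [← Matrix.dotProduct_mulVec, ← hpair x y]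
        exact h _
      have : x = 0 := by
        by_contra hx0
        exact hdet (Matrix.exists_vecMul_eq_zero_iff.1 ⟨x, hx0, hx⟩)
      subst this
      exact Subtype.ext (map_zero _)
    · rintro ⟨_, y, rfl⟩ h
      have hy : (M * N) *ᵥ y = 0 := by
        refine dotProduct_eq_zero _ fun x => ?_
        rw [dotProduct_comm, ← hpair x y]
        exact h _
      have : y = 0 := by
        by_contra hy0
        exact hdet (Matrix.exists_mulVec_eq_zero_iff.1 ⟨y, hy0, hy⟩)
      subst this
      exact Subtype.ext (map_zero _)

theorem hasDegenerateInvariants_iff {A B : Matrix (Fin n) (Fin n) K} :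
    HasDegenerateInvariants k A B ↔ ∃ P ∈ degeneratePairs K n k,
      IsInvariantCosubspace A P.1 ∧ IsInvariantSubspace B P.2 := by
  constructor
  · rintro ⟨M, M', N, N', α, β, h1, h2, h3, h4, h5⟩
    refine ⟨(LinearMap.range M.vecMulLinear, LinearMap.range N.mulVecLin), ⟨?_, ?_, ?_⟩, ?_, ?_⟩
    · have hinj : Function.Injective M.vecMulLinear := by
        intro x y hxy
        have := congrArg (· ᵥ* M') hxy
        simpa [Matrix.vecMul_vecMul, h1] using this
      simpa using LinearMap.finrank_range_of_inj hinj
    · have hinj : Function.Injective N.mulVecLin := by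
        intro x y hxy
        have := congrArg (N' *ᵥ ·) hxy
        simpa [Matrix.mulVec_mulVec, h2] using this
      simpa using LinearMap.finrank_range_of_inj hinj
    · exact fun h => (pairing_nondegenerate_iff h1).1 h h5
    · rintro _ ⟨x, rfl⟩
      refine ⟨x ᵥ* α, ?_⟩
      simp only [Matrix.vecMulLinear_apply]
      rw [Matrix.vecMul_vecMul, Matrix.vecMul_vecMul, h3]
    · rintro _ ⟨x, rfl⟩
      refine ⟨β *ᵥ x, ?_⟩
      simp only [Matrix.mulVecLin_apply]
      rw [Matrix.mulVec_mulVec, Matrix.mulVec_mulVec, h4]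
  · rintro ⟨⟨U, V⟩, ⟨hU, hV, hdeg⟩, hA, hB⟩
    obtain ⟨M, M', α, h1, h3, rfl⟩ := exists_rows_of_invariantCosubspace hU hA
    have hB' : IsInvariantCosubspace Bᵀ V := fun v hv => by
      rw [Matrix.vecMul_transpose]; exact hB v hv
    obtain ⟨N, N', β, h2, h4, rfl⟩ := exists_rows_of_invariantCosubspace hV hB'
    have h2' : N'ᵀ * Nᵀ = 1 := by rw [← Matrix.transpose_mul, h2, Matrix.transpose_one]
    have hN : LinearMap.range N.vecMulLinear = LinearMap.range Nᵀ.mulVecLin := by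
      congr 1
      refine LinearMap.ext fun x => ?_
      simp
    refine ⟨M, M', Nᵀ, N'ᵀ, α, βᵀ, h1, h2', h3, ?_, ?_⟩
    · rw [← Matrix.transpose_mul, ← h4, Matrix.transpose_mul, Matrix.transpose_transpose]
    · by_contra hdet
      have := (pairing_nondegenerate_iff h1).2 hdet
      rw [← hN] at this
      exact hdeg this

theorem mk_mem_invariantPairs_iff {A B : Matrix (Fin n) (Fin n) K} (hA : A ≠ 0) (hB : B ≠ 0) :
    (Projectivization.mk K A hA, Projectivization.mk K B hB) ∈ invariantPairs K n k ↔
      HasDegenerateInvariants k A B := by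
  constructor
  · rintro ⟨A', B', hA', hB', heq, h⟩
    rw [Prod.mk.injEq, Projectivization.mk_eq_mk_iff', Projectivization.mk_eq_mk_iff'] at heq
    obtain ⟨⟨s, rfl⟩, ⟨t, rfl⟩⟩ := heq
    exact (hasDegenerateInvariants_iff.2 h).smul s t
  · exact fun h => ⟨A, B, hA, hB, rfl, hasDegenerateInvariants_iff.1 h⟩

end Subspaces

/-! ### Frames sharing a first vector. -/

section Frames

variable {K : Type*} [Field K]

theorem exists_linearEquiv_apply_eq {V : Type*} [AddCommGroup V] [Module K V] {x y : V}
    (hx : x ≠ 0) (hy : y ≠ 0) : ∃ g : V ≃ₗ[K] V, g x = y := by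
  obtain ⟨g, hg⟩ := Submodule.exists_linearEquiv_restrict_eq
    ((LinearEquiv.toSpanNonzeroSingleton K V x hx).symm.trans
      (LinearEquiv.toSpanNonzeroSingleton K V y hy))
  refine ⟨g, ?_⟩
  have := hg ⟨x, Submodule.mem_span_singleton_self x⟩
  rw [← this, LinearEquiv.trans_apply,
    ((LinearEquiv.toSpanNonzeroSingleton K V x hx).symm_apply_eq).2
    (LinearEquiv.toSpanNonzeroSingleton_one K V x hx).symm,
    LinearEquiv.toSpanNonzeroSingleton_one]

/-- A linear equivalence carrying a given subspace and nonzero vector in it to another such pair. -/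
theorem exists_linearEquiv_map_eq {V : Type*} [AddCommGroup V] [Module K V] [FiniteDimensional K V]
    {E W : Submodule K V} (hd : Module.finrank K E = Module.finrank K W) {e w : V}
    (he : e ∈ E) (hw : w ∈ W) (he0 : e ≠ 0) (hw0 : w ≠ 0) :
    ∃ g : V ≃ₗ[K] V, g e = w ∧ ∀ x, g x ∈ W ↔ x ∈ E := by
  let φ : E ≃ₗ[K] W := LinearEquiv.ofFinrankEq E W hd
  -- An arbitrary equivalence `E ≃ W` is corrected by an automorphism of `W` so that `e` goes to
  -- `w`.
  obtain ⟨ψ, hψ⟩ := exists_linearEquiv_apply_eq (K := K) (x := φ ⟨e, he⟩) (y := (⟨w, hw⟩ : W))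
    (by rw [Ne, LinearEquiv.map_eq_zero_iff]; exact fun h => he0 (congrArg Subtype.val h))
    (fun h => hw0 (congrArg Subtype.val h))
  obtain ⟨g, hg⟩ := Submodule.exists_linearEquiv_restrict_eq (φ.trans ψ)
  refine ⟨g, ?_, fun x => ⟨fun hx => ?_, fun hx => ?_⟩⟩
  · rw [← hg ⟨e, he⟩, LinearEquiv.trans_apply, hψ]
  · have := hg ((φ.trans ψ).symm ⟨g x, hx⟩)
    rw [LinearEquiv.apply_symm_apply] at this
    rw [g.injective this]
    exact Subtype.property _
  · rw [← hg ⟨x, hx⟩]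
    exact Subtype.property _

variable (K) in
/-- The coordinate subspace spanned by the first `m` standard basis vectors. -/
def coordSubspace (n m : ℕ) : Submodule K (Fin n → K) where
  carrier := {x | ∀ i : Fin n, m ≤ i → x i = 0}
  add_mem' hx hy i hi := by simp [hx i hi, hy i hi]
  zero_mem' i _ := rfl
  smul_mem' c x hx i hi := by simp [hx i hi]

theorem finrank_coordSubspace {n m : ℕ} (hm : m ≤ n) :
    Module.finrank K (coordSubspace K n m) = m := by
  let e : coordSubspace K n m ≃ₗ[K] (Fin m → K) :=
    { toFun := fun x i => x.1 (Fin.castLE hm i)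
      invFun := fun y => ⟨fun i => if h : i.1 < m then y ⟨i, h⟩ else 0, fun i hi => by
        simp [not_lt.2 hi]⟩
      map_add' := fun _ _ => rfl
      map_smul' := fun _ _ => rfl
      left_inv := fun x => by
        ext i
        by_cases h : i.1 < m
        · simp [h]
        · simp [h, x.2 i (not_lt.1 h)]
      right_inv := fun y => by
        ext i
        simp }
  rw [e.finrank_eq, Module.finrank_fin_fun]

/-- An endomorphism preserving an `m`-dimensional subspace is block triangular in a basis whose
first vector is a prescribed nonzero vector of the subspace. -/
theorem exists_blockTriangular {n m : ℕ} (hm0 : 0 < m) (hm : m ≤ n)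
    {A : Matrix (Fin n) (Fin n) K} {W : Submodule K (Fin n → K)} (hW : Module.finrank K W = m)
    (hA : IsInvariantSubspace A W) {w : Fin n → K} (hw : w ∈ W) (hw0 : w ≠ 0) :
    ∃ p a : Matrix (Fin n) (Fin n) K, p.det ≠ 0 ∧ A * p = p * a ∧
      (∀ i, p i ⟨0, hm0.trans_le hm⟩ = w i) ∧ ∀ i j : Fin n, m ≤ i → j < m → a i j = 0 := by
  have hsingle : ∀ j : Fin n, j < m → (Pi.single j 1 : Fin n → K) ∈ coordSubspace K n m := by
    intro j hj i hi
    refine Pi.single_eq_of_ne (fun h => ?_) _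
    subst h
    omega
  obtain ⟨g, hg, hgW⟩ := exists_linearEquiv_map_eq (K := K) ((finrank_coordSubspace hm).trans hW.symm)
    (hsingle ⟨0, hm0.trans_le hm⟩ hm0) hw (by simp) hw0
  let p := LinearMap.toMatrix' g.toLinearMap
  have hp : ∀ x, p *ᵥ x = g x := fun x => LinearMap.toMatrix'_mulVec _ _
  let a := LinearMap.toMatrix' (g.symm.toLinearMap ∘ₗ A.mulVecLin ∘ₗ g.toLinearMap)
  have ha : ∀ x, a *ᵥ x = g.symm (A *ᵥ g x) := fun x => LinearMap.toMatrix'_mulVec _ _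
  refine ⟨p, a, ?_, ?_, ?_, ?_⟩
  · intro h0
    obtain ⟨x, hx0, hx⟩ := Matrix.exists_mulVec_eq_zero_iff.2 h0
    rw [hp, LinearEquiv.map_eq_zero_iff] at hx
    exact hx0 hx
  · refine Matrix.ext_of_mulVec_single fun i => ?_
    rw [← Matrix.mulVec_mulVec, ← Matrix.mulVec_mulVec, hp, hp, ha, LinearEquiv.apply_symm_apply]
  · intro i
    rw [← hg, ← hp, Matrix.mulVec_single_one]
    rfl
  · intro i j hi hj
    have h1 : a *ᵥ Pi.single j 1 ∈ coordSubspace K n m := by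
      rw [ha, ← hgW, LinearEquiv.apply_symm_apply]
      exact hA _ ((hgW _).2 (hsingle j hj))
    have := h1 i hi
    rwa [Matrix.mulVec_single_one] at this

/-- Degenerate invariants read off in two frames `p`, `q` with the same first vector: `A` preserves
the span of the first `n - k` vectors of `p` and `B` that of the first `k` vectors of `q`. -/
def IsFramed {n : ℕ} (k : ℕ) (hn : 0 < n) (A B p q a b : Matrix (Fin n) (Fin n) K) : Prop :=
  p.det ≠ 0 ∧ q.det ≠ 0 ∧ (∀ i, p i ⟨0, hn⟩ = q i ⟨0, hn⟩) ∧ A * p = p * a ∧ B * q = q * b ∧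
    (∀ i j : Fin n, n - k ≤ i → j < n - k → a i j = 0) ∧ ∀ i j : Fin n, k ≤ i → j < k → b i j = 0

variable {n k : ℕ}

theorem HasDegenerateInvariants.exists_isFramed (hk : 0 < k) (hkn : k < n)
    {A B : Matrix (Fin n) (Fin n) K} (h : HasDegenerateInvariants k A B) :
    ∃ p q a b, IsFramed k (hk.trans hkn) A B p q a b := by
  obtain ⟨M, M', N, N', α, β, h1, h2, h3, h4, h5⟩ := h
  -- The vector `N *ᵥ y` lies in the column space of `N` and in the kernel of `M`, and becomes the
  -- common first vector of both frames.
  obtain ⟨y, hy0, hy⟩ := Matrix.exists_mulVec_eq_zero_iff.2 h5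
  have hMs : Function.Surjective M.mulVecLin := fun x => ⟨M' *ᵥ x, by simp [h1]⟩
  have hNi : Function.Injective N.mulVecLin := by
    intro x y hxy
    have := congrArg (N' *ᵥ ·) hxy
    simpa [Matrix.mulVec_mulVec, h2] using this
  have hW : Module.finrank K (LinearMap.ker M.mulVecLin) = n - k := by
    have := M.mulVecLin.finrank_range_add_finrank_ker
    rw [LinearMap.range_eq_top.2 hMs, finrank_top, Module.finrank_fin_fun,
      Module.finrank_fin_fun] at this
    omega
  have hV : Module.finrank K (LinearMap.range N.mulVecLin) = k := by
    simpa using LinearMap.finrank_range_of_inj hNi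
  have hv0 : N *ᵥ y ≠ 0 := fun h0 => hy0 (hNi (by simpa using h0))
  obtain ⟨p, a, hp, hpa, hp0, ha⟩ := exists_blockTriangular (A := A) (w := N *ᵥ y)
    (Nat.sub_pos_of_lt hkn) (Nat.sub_le n k) hW
    (by
      intro w hw
      have hw' : M *ᵥ w = 0 := hw
      change M *ᵥ (A *ᵥ w) = 0
      rw [Matrix.mulVec_mulVec, h3, ← Matrix.mulVec_mulVec, hw', Matrix.mulVec_zero])
    (by
      change M *ᵥ (N *ᵥ y) = 0
      rw [Matrix.mulVec_mulVec, hy]) hv0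
  obtain ⟨q, b, hq, hqb, hq0, hb⟩ := exists_blockTriangular (A := B) (w := N *ᵥ y)
    hk hkn.le hV
    (by
      rintro _ ⟨x, rfl⟩
      refine ⟨β *ᵥ x, ?_⟩
      simp only [Matrix.mulVecLin_apply]
      rw [Matrix.mulVec_mulVec, Matrix.mulVec_mulVec, h4])
    ⟨y, rfl⟩ hv0
  exact ⟨p, q, a, b, hp, hq, fun i => (hp0 i).trans (hq0 i).symm, hpa, hqb, ha, hb⟩

/-- The row space is spanned by the last `k` rows of `p⁻¹`, which annihilate the first `n - k`
columns of `p`; the column space is spanned by the first `k` columns of `q`. -/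
theorem IsFramed.hasDegenerateInvariants (hk : 0 < k) (hkn : k < n)
    {A B p q a b : Matrix (Fin n) (Fin n) K} (h : IsFramed k (hk.trans hkn) A B p q a b) :
    HasDegenerateInvariants k A B := by
  obtain ⟨hp, hq, hpq, hpa, hqb, ha, hb⟩ := h
  have hp' := hp.isUnit
  have hq' := hq.isUnit
  let r : Fin k → Fin n := fun i => ⟨n - k + i, by omega⟩
  let s : Fin k → Fin n := Fin.castLE hkn.le
  have hr : Function.Injective r := fun i j hij => by
    have := congrArg Fin.val hij
    simp only [r] at this
    exact Fin.ext (by omega)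
  have hs : Function.Injective s := Fin.castLE_injective _
  have hpA : p⁻¹ * A = a * p⁻¹ := by
    rw [← Matrix.mul_one (p⁻¹ * A), ← Matrix.mul_nonsing_inv p hp', ← Matrix.mul_assoc,
      Matrix.mul_assoc p⁻¹, hpa, ← Matrix.mul_assoc p⁻¹, Matrix.nonsing_inv_mul _ hp',
      Matrix.one_mul]
  refine ⟨p⁻¹.submatrix r id, p.submatrix id r, q.submatrix id s, q⁻¹.submatrix s id,
    a.submatrix r r, b.submatrix s s, ?_, ?_, ?_, ?_, ?_⟩
  · rw [← Matrix.submatrix_mul _ _ _ _ _ Function.bijective_id, Matrix.nonsing_inv_mul _ hp',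
      Matrix.submatrix_one _ hr]
  · rw [← Matrix.submatrix_mul _ _ _ _ _ Function.bijective_id, Matrix.nonsing_inv_mul _ hq',
      Matrix.submatrix_one _ hs]
  · ext i j
    have h1 : (p⁻¹.submatrix r id * A) i j = (a * p⁻¹) (r i) j := by rw [← hpA]; rfl
    rw [h1, Matrix.mul_apply, Matrix.mul_apply]
    symm
    refine Fintype.sum_of_injective r hr _ _ (fun l hl => ?_) fun l => rfl
    rw [ha _ _ (Nat.le_add_right _ _), zero_mul]
    by_contra hl'
    exact hl ⟨⟨l - (n - k), by omega⟩, Fin.ext (by simp only [r]; omega)⟩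
  · ext i j
    have h1 : (B * q.submatrix id s) i j = (q * b) i (s j) := by rw [← hqb]; rfl
    rw [h1, Matrix.mul_apply, Matrix.mul_apply]
    symm
    refine Fintype.sum_of_injective s hs _ _ (fun l hl => ?_) fun l => rfl
    rw [hb _ _ _ (by simp [s]), mul_zero]
    by_contra hl'
    exact hl ⟨⟨l, by omega⟩, rfl⟩
  -- The shared first column turns this column of the pairing matrix into entries of `p⁻¹ * p` in
  -- rows at least `n - k > 0`, all off the diagonal.
  · refine Matrix.det_eq_zero_of_column_eq_zero ⟨0, hk⟩ fun i => ?_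
    have h1 : (p⁻¹.submatrix r id * q.submatrix id s) i ⟨0, hk⟩ =
        (p⁻¹ * p) (r i) ⟨0, hk.trans hkn⟩ := by
      rw [Matrix.mul_apply, Matrix.mul_apply]
      refine Finset.sum_congr rfl fun l _ => ?_
      rw [hpq l]
      rfl
    rw [h1, Matrix.nonsing_inv_mul _ hp', Matrix.one_apply_ne]
    intro h0
    have := congrArg Fin.val h0
    simp only [r] at this
    omega

end Frames

/-! ### Rational curves and irreducibility. -/

section Irreducibility

open Polynomial

variable {K : Type*} [Field K] {n k : ℕ}

/-- The line through two matrices, as a matrix of polynomials in the parameter. -/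
def matrixLine (p₁ p₂ : Matrix (Fin n) (Fin n) K) : Matrix (Fin n) (Fin n) K[X] :=
  p₁.map C + (X : K[X]) • (p₂ - p₁).map C

theorem matrixLine_map_eval (p₁ p₂ : Matrix (Fin n) (Fin n) K) (t : K) :
    (matrixLine p₁ p₂).map (evalRingHom t) = p₁ + t • (p₂ - p₁) := by
  ext i j
  simp [matrixLine]

/-- Conjugation of `a` by `p`, with denominators cleared. -/
def adjConj {R : Type*} [CommRing R] (p a : Matrix (Fin n) (Fin n) R) : Matrix (Fin n) (Fin n) R :=
  p * a * p.adjugate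

theorem adjConj_map {R S : Type*} [CommRing R] [CommRing S] (φ : R →+* S)
    (p a : Matrix (Fin n) (Fin n) R) : (adjConj p a).map φ = adjConj (p.map φ) (a.map φ) := by
  rw [adjConj, Matrix.map_mul, Matrix.map_mul, adjConj, ← RingHom.mapMatrix_apply φ p.adjugate,
    RingHom.map_adjugate, RingHom.mapMatrix_apply]

theorem adjConj_eq_smul {R : Type*} [CommRing R] {A p a : Matrix (Fin n) (Fin n) R}
    (h : A * p = p * a) : adjConj p a = p.det • A := by
  rw [adjConj, ← h, Matrix.mul_assoc, Matrix.mul_adjugate, Matrix.mul_smul, Matrix.mul_one]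

theorem adjConj_mul {R : Type*} [CommRing R] (p a : Matrix (Fin n) (Fin n) R) :
    adjConj p a * p = p * (p.det • a) := by
  rw [adjConj, Matrix.mul_assoc, Matrix.adjugate_mul, Matrix.mul_smul, Matrix.mul_one,
    Matrix.mul_smul]

/-- Two pairs with degenerate invariants lie on a rational curve of such pairs. -/
theorem exists_polynomial_curve (hk : 0 < k) (hkn : k < n)
    {A₁ B₁ A₂ B₂ : Matrix (Fin n) (Fin n) K}
    (h₁ : HasDegenerateInvariants k A₁ B₁) (h₂ : HasDegenerateInvariants k A₂ B₂) :
    ∃ (A B : Matrix (Fin n) (Fin n) K[X]) (d : K[X]) (c₁ c₁' c₂ c₂' : K), d ≠ 0 ∧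
      c₁ ≠ 0 ∧ c₁' ≠ 0 ∧ c₂ ≠ 0 ∧ c₂' ≠ 0 ∧
      A.map (evalRingHom 0) = c₁ • A₁ ∧ B.map (evalRingHom 0) = c₁' • B₁ ∧
      A.map (evalRingHom 1) = c₂ • A₂ ∧ B.map (evalRingHom 1) = c₂' • B₂ ∧
      ∀ t, d.eval t ≠ 0 →
        HasDegenerateInvariants k (A.map (evalRingHom t)) (B.map (evalRingHom t)) := by
  obtain ⟨p₁, q₁, a₁, b₁, hp₁, hq₁, hpq₁, hpa₁, hqb₁, ha₁, hb₁⟩ := h₁.exists_isFramed hk hkn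
  obtain ⟨p₂, q₂, a₂, b₂, hp₂, hq₂, hpq₂, hpa₂, hqb₂, ha₂, hb₂⟩ := h₂.exists_isFramed hk hkn
  have h0 : ∀ m₁ m₂ : Matrix (Fin n) (Fin n) K, (matrixLine m₁ m₂).map (evalRingHom 0) = m₁ :=
    fun m₁ m₂ => by rw [matrixLine_map_eval, zero_smul, add_zero]
  have h1 : ∀ m₁ m₂ : Matrix (Fin n) (Fin n) K, (matrixLine m₁ m₂).map (evalRingHom 1) = m₂ :=
    fun m₁ m₂ => by rw [matrixLine_map_eval, one_smul, add_sub_cancel]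
  have hdet : ∀ (m : Matrix (Fin n) (Fin n) K[X]) t,
      m.det.eval t = (m.map (evalRingHom t)).det := fun m t =>
    RingHom.map_det (evalRingHom t) m
  have hline : ∀ m₁ m₂ : Matrix (Fin n) (Fin n) K, m₁.det ≠ 0 → (matrixLine m₁ m₂).det ≠ 0 := by
    intro m₁ m₂ hm hz
    have := hdet (matrixLine m₁ m₂) 0
    rw [hz, h0, eval_zero] at this
    exact hm this.symm
  -- All four parameters move along lines; the endpoints are recovered up to the nonzero scalars
  -- `det pᵢ` and `det qᵢ`.
  refine ⟨adjConj (matrixLine p₁ p₂) (matrixLine a₁ a₂),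
    adjConj (matrixLine q₁ q₂) (matrixLine b₁ b₂),
    (matrixLine p₁ p₂).det * (matrixLine q₁ q₂).det, p₁.det, q₁.det, p₂.det, q₂.det,
    mul_ne_zero (hline _ _ hp₁) (hline _ _ hq₁), hp₁, hq₁, hp₂, hq₂, ?_, ?_, ?_, ?_, ?_⟩
  · rw [adjConj_map, h0, h0, adjConj_eq_smul hpa₁]
  · rw [adjConj_map, h0, h0, adjConj_eq_smul hqb₁]
  · rw [adjConj_map, h1, h1, adjConj_eq_smul hpa₂]
  · rw [adjConj_map, h1, h1, adjConj_eq_smul hqb₂]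
  · intro t ht
    rw [eval_mul, hdet, hdet] at ht
    rw [adjConj_map, adjConj_map]
    refine IsFramed.hasDegenerateInvariants hk hkn ⟨left_ne_zero_of_mul ht,
      right_ne_zero_of_mul ht, ?_, adjConj_mul _ _, adjConj_mul _ _, ?_, ?_⟩
    · intro i
      simp [matrixLine, hpq₁ i, hpq₂ i]
    · intro i j hi hj
      simp [matrixLine, ha₁ i j hi hj, ha₂ i j hi hj]
    · intro i j hi hj
      simp [matrixLine, hb₁ i j hi hj, hb₂ i j hi hj]

theorem exists_entry_eval_ne_zero {A : Matrix (Fin n) (Fin n) K[X]} {t : K}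
    (h : A.map (evalRingHom t) ≠ 0) : ∃ i j, (A i j).eval t ≠ 0 := by
  by_contra! hc
  exact h (by ext i j; exact hc i j)

theorem exists_eval_ne_zero [Infinite K] {f : K[X]} (hf : f ≠ 0) : ∃ t, f.eval t ≠ 0 := by
  by_contra! hc
  exact hf (Polynomial.funext fun t => by rw [hc, eval_zero])

theorem mk_smul_eq {A A' : Matrix (Fin n) (Fin n) K} {c : K} (h : A' = c • A) (hA : A ≠ 0)
    (hA' : A' ≠ 0) : Projectivization.mk K A hA = Projectivization.mk K A' hA' :=
  ((Projectivization.mk_eq_mk_iff' K _ _ _ _).2 ⟨c, h.symm⟩).symm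

theorem isAlgebraicSet_compl_of_isOpen {u : Set (ProjPairs K n)}
    (h : @IsOpen _ (zariskiTopology K n) u) : IsAlgebraicSet uᶜ := h

theorem isPreirreducible_invariantPairs [Infinite K] (hk : 0 < k) (hkn : k < n) :
    @IsPreirreducible _ (zariskiTopology K n) (invariantPairs K n k) := by
  rintro u v hu hv ⟨x₁, hx₁, hxu⟩ ⟨x₂, hx₂, hxv⟩
  obtain ⟨A₁, B₁, hA₁, hB₁, rfl, h₁⟩ := hx₁
  obtain ⟨A₂, B₂, hA₂, hB₂, rfl, h₂⟩ := hx₂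
  obtain ⟨S, -, hS⟩ := isAlgebraicSet_compl_of_isOpen hu
  obtain ⟨T, -, hT⟩ := isAlgebraicSet_compl_of_isOpen hv
  obtain ⟨A, B, d, c₁, c₁', c₂, c₂', hd, hc₁, hc₁', hc₂, hc₂', eA₁, eB₁, eA₂, eB₂, hAB⟩ :=
    exists_polynomial_curve hk hkn (hasDegenerateInvariants_iff.2 h₁)
      (hasDegenerateInvariants_iff.2 h₂)
  have nA₁ : A.map (evalRingHom 0) ≠ 0 := eA₁ ▸ smul_ne_zero hc₁ hA₁
  have nB₁ : B.map (evalRingHom 0) ≠ 0 := eB₁ ▸ smul_ne_zero hc₁' hB₁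
  have nA₂ : A.map (evalRingHom 1) ≠ 0 := eA₂ ▸ smul_ne_zero hc₂ hA₂
  have nB₂ : B.map (evalRingHom 1) ≠ 0 := eB₂ ▸ smul_ne_zero hc₂' hB₂
  rw [mk_smul_eq eA₁ hA₁ nA₁, mk_smul_eq eB₁ hB₁ nB₁] at hxu
  rw [mk_smul_eq eA₂ hA₂ nA₂, mk_smul_eq eB₂ hB₂ nB₂] at hxv
  obtain ⟨f, hf, hf0⟩ : ∃ f ∈ S, evalPair (A.map (evalRingHom 0)) (B.map (evalRingHom 0)) f ≠ 0 := by
    by_contra! hc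
    exact (hS _ _ nA₁ nB₁).2 hc hxu
  obtain ⟨g, hg, hg0⟩ : ∃ g ∈ T, evalPair (A.map (evalRingHom 1)) (B.map (evalRingHom 1)) g ≠ 0 := by
    by_contra! hc
    exact (hT _ _ nA₂ nB₂).2 hc hxv
  obtain ⟨i, j, hij⟩ := exists_entry_eval_ne_zero nA₁
  obtain ⟨i', j', hij'⟩ := exists_entry_eval_ne_zero nB₁
  let pull (f : PairPoly K n) : K[X] :=
    MvPolynomial.aeval (Sum.elim (fun p => A p.1 p.2) (fun p => B p.1 p.2)) f
  have hpull : ∀ f t, (pull f).eval t =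
      evalPair (A.map (evalRingHom t)) (B.map (evalRingHom t)) f := by
    intro f t
    refine (eval_aeval_polynomial _ _ _).trans ?_
    rw [evalPair]
    congr 2
    ext (p | p) <;> rfl
  have hne : ∀ {f : K[X]} {t : K}, f.eval t ≠ 0 → f ≠ 0 := by
    rintro _ t h rfl
    exact h eval_zero
  -- One parameter avoids the zeros of five polynomials: `d` keeps the frames invertible, the
  -- pullbacks of `f` and `g` keep the point in both open sets, and one entry of each matrix keeps
  -- its projective class defined.
  obtain ⟨t, ht⟩ := exists_eval_ne_zero (mul_ne_zero (mul_ne_zero hd (mul_ne_zero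
    (hne ((hpull f 0).trans_ne hf0)) (hne ((hpull g 1).trans_ne hg0))))
    (mul_ne_zero (hne hij) (hne hij')))
  simp only [eval_mul, mul_ne_zero_iff, hpull] at ht
  obtain ⟨⟨htd, htf, htg⟩, htA, htB⟩ := ht
  have nA : A.map (evalRingHom t) ≠ 0 := fun h => htA (congrFun (congrFun h i) j)
  have nB : B.map (evalRingHom t) ≠ 0 := fun h => htB (congrFun (congrFun h i') j')
  refine ⟨(Projectivization.mk K _ nA, Projectivization.mk K _ nB),
    (mk_mem_invariantPairs_iff nA nB).2 (hAB t htd), ?_, ?_⟩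
  · by_contra hc
    exact htf ((hS _ _ nA nB).1 hc f hf)
  · by_contra hc
    exact htg ((hT _ _ nA nB).1 hc g hg)

theorem invariantPairs_nonempty (hk : 0 < k) (hkn : k < n) : (invariantPairs K n k).Nonempty := by
  have : Nonempty (Fin n) := ⟨⟨0, hk.trans hkn⟩⟩
  have h1 : (1 : Matrix (Fin n) (Fin n) K) ≠ 0 := one_ne_zero
  have hzero : ∀ (m : ℕ) (i j : Fin n), m ≤ i → j < m → (1 : Matrix (Fin n) (Fin n) K) i j = 0 :=
    fun m i j hi hj => Matrix.one_apply_ne (by rintro rfl; omega)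
  refine ⟨_, (mk_mem_invariantPairs_iff h1 h1).2
    (IsFramed.hasDegenerateInvariants (p := 1) (q := 1) (a := 1) (b := 1) hk hkn
      ⟨by simp, by simp, fun _ => rfl, rfl, rfl, hzero _, hzero _⟩)⟩

end Irreducibility

theorem isAlgebraicSet_invariantPairs {K : Type*} [Field K] [IsAlgClosed K] {n k : ℕ} :
    IsAlgebraicSet (invariantPairs K n k) := by
  have : Infinite K := IsAlgClosed.instInfinite
  refine ⟨{f | IsBihomogeneous f ∧ ∀ A B, HasDegenerateInvariants k A B → evalPair A B f = 0},
    fun f hf => hf.1, fun A B hA hB => ?_⟩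
  rw [mk_mem_invariantPairs_iff hA hB]
  refine ⟨fun h f hf => hf.2 A B h, fun h => ?_⟩
  exact hasDegenerateInvariants_of_forall_evalPair_eq_zero fun f hf =>
    evalPair_eq_zero_of_bihomogeneous (C := HasDegenerateInvariants k)
      (fun A B s t h => h.smul s t) (fun f hb hf => h f ⟨hb, hf⟩) hf

end MatrixPairs

end

theorem mainTheorem12 (K : Type*) [Field K] [IsAlgClosed K] (n k : ℕ) (hk : 0 < k) (hkn : k < n) :
    MatrixPairs.IsIrreducibleProjectiveVariety (MatrixPairs.invariantPairs K n k) := by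
  have : Infinite K := IsAlgClosed.instInfinite
  refine ⟨?_, MatrixPairs.invariantPairs_nonempty hk hkn,
    MatrixPairs.isPreirreducible_invariantPairs hk hkn⟩
  -- Closed means open complement, and open means algebraic complement, hence the double complement
  -- to cancel.
  let _ := MatrixPairs.zariskiTopology K n
  refine ⟨?_⟩
  change MatrixPairs.IsAlgebraicSet _
  rw [compl_compl]
  exact MatrixPairs.isAlgebraicSet_invariantPairs
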